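/- For $\gamma>0$ let $PW_\gamma$ be the space of all $f\in L^2(\mathbb R)$ whose Fourier transform $\hat f(\xi)=\int f(x)e^{-ix\xi}\,dx$ (in the Plancherel sense) vanishes for almost every $\xi\notin[-\gamma,\gamma]$. Each such $f$ is identified with its entire extension, and $f^\sharp(z)=\overline{f(\bar z)}$. Write $f\sim g$ if $f=\lambda g$ or $f=\lambda g^\sharp$ for some $\lambda\in\mathbb C$ with $|\lambda|=1$, and equip $PW_\gamma/\!\sim$ with the metric $d([f],[g])=\inf\{\|h_1-h_2\|_{L^2(\mathbb R)} : h_1\in[f],\ h_2\in[g]\}$. Let $(t_n)_{n\in\mathbb Z}\subset\mathbb R$ be a set of sampling for $PW_{2\gamma}$, that is, there are constants $A,B>0$ with $A\|f\|^2\le\sum_n|f(t_n)|^2\le B\|f\|^2$ for all $f\in PW_{2\gamma}$. Then the following hold. 1. For every $b>0$ the map $$\mathcal A:PW_\gamma/\!\sim\ \to\ \ell^2(\mathbb Z)\oplus\ell^2(\mathbb Z),\qquad \mathcal A([f])=\big(|f(t_n)|,\ |f(t_n+b)-f(t_n)|\big)_{n\in\mathbb Z}$$ is well defined and its range $\mathcal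 R(\mathcal A)$ is closed. If moreover $0<b<\pi/\gamma$, then $\mathcal A$ is one-to-one and $\mathcal A^{-1}:\mathcal R(\mathcal A)\to PW_\gamma/\!\sim$ is continuous. 2. The map $$\widetilde{\mathcal A}:PW_\gamma/\!\sim\ \to\ \ell^2(\mathbb Z)\oplus\ell^2(\mathbb Z),\qquad \widetilde{\mathcal A}([f])=\big(|f(t_n)|,\ |f'(t_n)|\big)_{n\in\mathbb Z}$$ is well defined and one-to-one, its range $\mathcal R(\widetilde{\mathcal A})$ is closed, and $\widetilde{\mathcal A}^{-1}:\mathcal R(\widetilde{\mathcal A})\to PW_\gamma/\!\sim$ is continuous. -/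

import Mathlib

open MeasureTheory Filter Topology
open scoped FourierTransform ComplexConjugate ENNReal

noncomputable section

/-- The Paley-Wiener space `PW_γ`. An element is the entire extension of a function in `L²(ℝ)` whose
(Plancherel) Fourier transform vanishes almost everywhere outside `[-γ, γ]`, the frequency variable
being the angular one, so that `PW_π` has Nyquist density one. Mathlib's `𝓕` has the kernel
`exp (-2 π i x ξ)`, so its variable `ξ` corresponds to the angular frequency `2 π ξ`. -/
@[ext]
structure PW (γ : ℝ) where
  toFun : ℂ → ℂ
  entire : Differentiable ℂ toFun
  memLp : MemLp (fun x : ℝ => toFun x) 2 (volume : Measure ℝ)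
  bandlimited : ∀ᵐ ξ : ℝ, γ < |2 * Real.pi * ξ| → (𝓕 (memLp.toLp : Lp ℂ 2 (volume : Measure ℝ))) ξ = 0

namespace PW

variable {γ : ℝ}

instance : CoeFun (PW γ) (fun _ => ℂ → ℂ) := ⟨PW.toFun⟩

/-- The restriction to the real line, as an element of `L²(ℝ)`. -/
def toL2 (f : PW γ) : Lp ℂ 2 (volume : Measure ℝ) := f.memLp.toLp

/-- Multiplication by scalars. -/
instance : SMul ℂ (PW γ) where
  smul c f :=
    { toFun := fun z => c * f z
      entire := f.entire.const_mul c
      memLp := f.memLp.const_mul c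
      bandlimited := by
        have h : (f.memLp.const_mul c).toLp = c • f.toL2 := MemLp.toLp_const_smul c f.memLp
        rw [h, FourierTransform.fourier_smul]
        filter_upwards [f.bandlimited, Lp.coeFn_smul c (𝓕 f.toL2)] with ξ h1 h2 h3
        rw [h2, Pi.smul_apply]
        change c • (𝓕 f.memLp.toLp : Lp ℂ 2 (volume : Measure ℝ)) ξ = 0
        rw [h1 h3, smul_zero] }

@[simp] theorem smul_apply (c : ℂ) (f : PW γ) (z : ℂ) : (c • f) z = c * f z := rfl

theorem toL2_smul (c : ℂ) (f : PW γ) : (c • f).toL2 = c • f.toL2 :=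
  MemLp.toLp_const_smul c f.memLp

/-- Conjugation is isometric on `L²(ℝ)`. -/
theorem norm_star_sub_star (f g : Lp ℂ 2 (volume : Measure ℝ)) :
    ‖star f - star g‖ = ‖f - g‖ := by
  rw [Lp.norm_def, Lp.norm_def]
  congr 1
  apply eLpNorm_congr_norm_ae
  filter_upwards [Lp.coeFn_sub (star f) (star g), Lp.coeFn_sub f g, Lp.coeFn_star f,
    Lp.coeFn_star g] with x h1 h2 h3 h4
  rw [h1, h2, Pi.sub_apply, Pi.sub_apply, h3, h4, Pi.star_apply, Pi.star_apply, ← star_sub,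
    norm_star]

/-- Complex conjugation of Schwartz functions. -/
def schwartzConj : SchwartzMap ℝ ℂ →L[ℝ] SchwartzMap ℝ ℂ :=
  SchwartzMap.postcompCLM (𝕜 := ℝ) (Complex.conjCLE : ℂ →L[ℝ] ℂ)

theorem star_toLp (f : SchwartzMap ℝ ℂ) : star (f.toLp 2) = (schwartzConj f).toLp 2 := by
  apply Lp.ext
  filter_upwards [Lp.coeFn_star (f.toLp 2 (volume : Measure ℝ)), f.coeFn_toLp 2,
    (schwartzConj f).coeFn_toLp 2] with x h1 h2 h3
  rw [h1, h3, Pi.star_apply, h2]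
  rfl

theorem fourier_schwartzConj (f : SchwartzMap ℝ ℂ) (ξ : ℝ) :
    𝓕 (schwartzConj f) ξ = conj (𝓕 f (-ξ)) := by
  rw [SchwartzMap.fourier_coe, SchwartzMap.fourier_coe, Real.fourier_eq', Real.fourier_eq',
    ← integral_conj]
  congr 1
  ext v
  have h : (schwartzConj f) v = conj (f v) := rfl
  rw [h]
  simp only [smul_eq_mul, map_mul, ← Complex.exp_conj]
  congr 2
  simp [Complex.conj_ofNat]

/-- The Fourier transform of the conjugate of `f` is the reflected conjugate of that of `f`. -/
theorem fourier_star (f : Lp ℂ 2 (volume : Measure ℝ)) :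
    𝓕 (star f) =
      Lp.compMeasurePreserving (Neg.neg : ℝ → ℝ) (Measure.measurePreserving_neg volume)
        (star (𝓕 f)) := by
  have hstar : Continuous (star : Lp ℂ 2 (volume : Measure ℝ) → Lp ℂ 2 (volume : Measure ℝ)) :=
    (Isometry.of_dist_eq fun f g => by
      rw [dist_eq_norm, dist_eq_norm, norm_star_sub_star]).continuous
  have hF : Continuous (𝓕 : Lp ℂ 2 (volume : Measure ℝ) → Lp ℂ 2 (volume : Measure ℝ)) :=
    FourierTransform.continuous_fourier
  have hR := (Lp.isometry_compMeasurePreserving (E := ℂ) (p := 2)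
    (Measure.measurePreserving_neg (volume : Measure ℝ))).continuous
  have hd : DenseRange (SchwartzMap.toLpCLM ℝ ℂ 2 (volume : Measure ℝ)) :=
    SchwartzMap.denseRange_toLpCLM ENNReal.ofNat_ne_top
  refine congrFun (hd.equalizer (hF.comp hstar) (hR.comp (hstar.comp hF)) ?_) f
  ext1 φ
  change 𝓕 (star (φ.toLp 2)) = Lp.compMeasurePreserving (Neg.neg : ℝ → ℝ)
    (Measure.measurePreserving_neg volume) (star (𝓕 (φ.toLp 2)))
  rw [star_toLp, SchwartzMap.toLp_fourier_eq, SchwartzMap.toLp_fourier_eq, star_toLp]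
  apply Lp.ext
  have hq := (Measure.measurePreserving_neg (volume : Measure ℝ)).quasiMeasurePreserving
  filter_upwards [Lp.coeFn_compMeasurePreserving ((schwartzConj (𝓕 φ)).toLp 2 volume)
      (Measure.measurePreserving_neg (volume : Measure ℝ)),
    (𝓕 (schwartzConj φ)).coeFn_toLp 2,
    hq.ae ((schwartzConj (𝓕 φ)).coeFn_toLp 2 volume)] with ξ h1 h2 h3
  rw [h1, h2, Function.comp_apply, h3, fourier_schwartzConj]
  rfl

theorem toLp_conj {F : ℂ → ℂ} (h : MemLp (fun x : ℝ => F x) 2 (volume : Measure ℝ))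
    (h' : MemLp (fun x : ℝ => conj (F (conj (x : ℂ)))) 2 (volume : Measure ℝ)) :
    h'.toLp = star h.toLp := by
  apply Lp.ext
  filter_upwards [h'.coeFn_toLp, h.coeFn_toLp, Lp.coeFn_star h.toLp] with x h1 h2 h3
  rw [h1, h3, Pi.star_apply, h2, Complex.conj_ofReal]
  rfl

/-- The function `f^♯ (z) = conj (f (conj z))`, again an element of `PW_γ`. -/
def sharp (f : PW γ) : PW γ where
  toFun := fun z => conj (f (conj z))
  entire := fun z => by
    have h := (f.entire (conj z)).conj_conj
    rw [Complex.conj_conj] at h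
    exact h
  memLp := by
    simp only [Complex.conj_ofReal]
    exact f.memLp.star
  bandlimited := by
    rw [toLp_conj f.memLp, fourier_star]
    have hq := (Measure.measurePreserving_neg (volume : Measure ℝ)).quasiMeasurePreserving
    filter_upwards [hq.ae f.bandlimited,
      Lp.coeFn_compMeasurePreserving (star (𝓕 f.memLp.toLp))
        (Measure.measurePreserving_neg (volume : Measure ℝ)),
      hq.ae (Lp.coeFn_star (𝓕 f.memLp.toLp))] with ξ h1 h2 h3 h4
    rw [h2, Function.comp_apply, h3, Pi.star_apply, h1 (by simpa using h4), star_zero]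

@[simp] theorem sharp_apply (f : PW γ) (z : ℂ) : f.sharp z = conj (f (conj z)) := rfl

theorem toL2_sharp (f : PW γ) : f.sharp.toL2 = star f.toL2 := toLp_conj f.memLp _

/-- The relation `f ∼ g`: `f = c g` or `f = c g^♯` for a unimodular constant `c`. -/
def Equivalent (f g : PW γ) : Prop :=
  ∃ c : ℂ, ‖c‖ = 1 ∧ (f = c • g ∨ f = c • g.sharp)

theorem one_smul' (f : PW γ) : (1 : ℂ) • f = f := by ext z; simp

theorem smul_smul' (c d : ℂ) (f : PW γ) : c • d • f = (c * d) • f := by ext z; simp [mul_assoc]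

theorem sharp_smul (c : ℂ) (f : PW γ) : (c • f).sharp = conj c • f.sharp := by ext z; simp

theorem sharp_sharp (f : PW γ) : f.sharp.sharp = f := by ext z; simp

theorem Equivalent.refl (f : PW γ) : Equivalent f f :=
  ⟨1, by simp, Or.inl (one_smul' f).symm⟩

theorem Equivalent.symm {f g : PW γ} (h : Equivalent f g) : Equivalent g f := by
  obtain ⟨c, hc, h | h⟩ := h
  · refine ⟨c⁻¹, by simp [hc], Or.inl ?_⟩
    have hc0 : c ≠ 0 := by rintro rfl; simp at hc
    rw [h, smul_smul', inv_mul_cancel₀ hc0, one_smul']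
  · refine ⟨c, hc, Or.inr ?_⟩
    rw [h, sharp_smul, smul_smul', sharp_sharp, Complex.mul_conj, Complex.normSq_eq_norm_sq, hc]
    simp [one_smul']

theorem Equivalent.trans {f g h : PW γ} (h₁ : Equivalent f g) (h₂ : Equivalent g h) :
    Equivalent f h := by
  obtain ⟨c, hc, h₁⟩ := h₁
  obtain ⟨d, hd, h₂⟩ := h₂
  rcases h₁ with h₁ | h₁ <;> rcases h₂ with h₂ | h₂ <;> rw [h₁, h₂]
  · exact ⟨c * d, by simp [hc, hd], Or.inl (smul_smul' _ _ _)⟩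
  · exact ⟨c * d, by simp [hc, hd], Or.inr (smul_smul' _ _ _)⟩
  · exact ⟨c * conj d, by simp [hc, hd], Or.inr (by rw [sharp_smul, smul_smul'])⟩
  · exact ⟨c * conj d, by simp [hc, hd], Or.inl (by rw [sharp_smul, smul_smul', sharp_sharp])⟩

instance setoid (γ : ℝ) : Setoid (PW γ) :=
  ⟨Equivalent, Equivalent.refl, Equivalent.symm, Equivalent.trans⟩

/-- A pair can be moved so that its second entry is any prescribed equivalent function. -/
theorem exists_moved {f g g' : PW γ} (h : Equivalent g' g) :
    ∃ f' : PW γ, Equivalent f' f ∧ ‖f'.toL2 - g'.toL2‖ = ‖f.toL2 - g.toL2‖ := by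
  obtain ⟨c, hc, h | h⟩ := h
  · refine ⟨c • f, ⟨c, hc, Or.inl rfl⟩, ?_⟩
    rw [h, toL2_smul, toL2_smul, ← smul_sub, norm_smul, hc, one_mul]
  · refine ⟨c • f.sharp, ⟨c, hc, Or.inr rfl⟩, ?_⟩
    rw [h, toL2_smul, toL2_smul, ← smul_sub, norm_smul, hc, one_mul, toL2_sharp, toL2_sharp,
      norm_star_sub_star]

end PW

/-- The quotient `PW_γ / ∼`. -/
def PWQuotient (γ : ℝ) : Type := Quotient (PW.setoid γ)

namespace PWQuotient

variable {γ : ℝ}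

/-- The equivalence class `[f]`. -/
def mk (f : PW γ) : PWQuotient γ := Quotient.mk (PW.setoid γ) f

theorem mk_eq_mk {f g : PW γ} : mk f = mk g ↔ PW.Equivalent f g := Quotient.eq

theorem exists_rep (p : PWQuotient γ) : ∃ f : PW γ, mk f = p := Quotient.exists_rep p

/-- The `L²` distances between the representatives of two classes. -/
def distSet (p q : PWQuotient γ) : Set ℝ :=
  {r | ∃ f g : PW γ, mk f = p ∧ mk g = q ∧ r = ‖f.toL2 - g.toL2‖}

theorem distSet_nonneg {p q : PWQuotient γ} {r : ℝ} (h : r ∈ distSet p q) : 0 ≤ r := by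
  obtain ⟨f, g, -, -, rfl⟩ := h
  exact norm_nonneg _

theorem distSet_nonempty (p q : PWQuotient γ) : (distSet p q).Nonempty := by
  obtain ⟨f, rfl⟩ := exists_rep p
  obtain ⟨g, rfl⟩ := exists_rep q
  exact ⟨_, f, g, rfl, rfl, rfl⟩

theorem distSet_bddBelow (p q : PWQuotient γ) : BddBelow (distSet p q) :=
  ⟨0, fun _ h => distSet_nonneg h⟩

/-- The quotient metric: `d([f], [g])` is the infimum of `‖h₁ - h₂‖` over `h₁ ∈ [f]` and
`h₂ ∈ [g]`. -/
instance : PseudoMetricSpace (PWQuotient γ) where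
  dist p q := sInf (distSet p q)
  dist_self p := by
    obtain ⟨f, rfl⟩ := exists_rep p
    refine le_antisymm (csInf_le (distSet_bddBelow _ _) ⟨f, f, rfl, rfl, by simp⟩) ?_
    exact le_csInf (distSet_nonempty _ _) fun _ h => distSet_nonneg h
  dist_comm p q := by
    have h : distSet p q = distSet q p := by
      ext r
      constructor <;> rintro ⟨f, g, hf, hg, rfl⟩ <;>
        exact ⟨g, f, hg, hf, norm_sub_rev _ _⟩
    change sInf (distSet p q) = sInf (distSet q p)
    rw [h]
  dist_triangle p q r := by
    refine le_of_forall_pos_le_add fun ε hε => ?_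
    obtain ⟨_, ⟨f, g, hf, hg, rfl⟩, h1⟩ :=
      exists_lt_of_csInf_lt (distSet_nonempty p q) (lt_add_of_pos_right _ (half_pos hε))
    obtain ⟨_, ⟨g', k, hg', hk, rfl⟩, h2⟩ :=
      exists_lt_of_csInf_lt (distSet_nonempty q r) (lt_add_of_pos_right _ (half_pos hε))
    obtain ⟨f', hf', h3⟩ := PW.exists_moved (f := f) (mk_eq_mk.1 (hg'.trans hg.symm))
    have h4 : sInf (distSet p r) ≤ ‖f'.toL2 - k.toL2‖ :=
      csInf_le (distSet_bddBelow _ _) ⟨f', k, (mk_eq_mk.2 hf').trans hf, hk, rfl⟩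
    have h5 := norm_sub_le_norm_sub_add_norm_sub f'.toL2 g'.toL2 k.toL2
    linarith

end PWQuotient

/-- `t` is a set of sampling for `PW_γ`: there are `A, B > 0` such that
`A ‖f‖² ≤ ∑ |f (t n)|² ≤ B ‖f‖²` for all `f` in `PW_γ`. -/
def IsSetOfSampling (γ : ℝ) (t : ℤ → ℝ) : Prop :=
  ∃ A B : ℝ, 0 < A ∧ 0 < B ∧ ∀ f : PW γ,
    Summable (fun n => ‖f (t n)‖ ^ 2) ∧
    A * ‖f.toL2‖ ^ 2 ≤ ∑' n, ‖f (t n)‖ ^ 2 ∧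
    ∑' n, ‖f (t n)‖ ^ 2 ≤ B * ‖f.toL2‖ ^ 2

/-- The Hilbert space `ℓ²(ℤ) ⊕ ℓ²(ℤ)` of pairs of real sequences. -/
abbrev PairSpace : Type := WithLp 2 (lp (fun _ : ℤ => ℝ) 2 × lp (fun _ : ℤ => ℝ) 2)

end

/-! On the real line `f f^♯ = |f|²`, and `f f^♯` lies in `PW_{2γ}`. The moduli `|f (t n)|` on a set
of sampling for `PW_{2γ}` therefore determine the entire function `f f^♯`. The same applies to `L
f`, where `L` is the difference operator or the derivative.

Suppose `f` and `g` have the same data. Write `f₁` for the translate or the derivative of `f`, and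
`g₁` likewise. Expanding the difference, or differentiating `f f^♯ = g g^♯`, gives the mixed
identity `f₁ f^♯ + f f₁^♯ = g₁ g^♯ + g g₁^♯`. With the two product identities it yields `(f₁ g - f
g₁) (f₁ g^♯ - f g₁^♯) = 0` (`mul_sub_mul_eq_zero`). A product of entire functions vanishes only if a
factor does. So, with `h` equal to `g` or `g^♯`, either `f / h` has zero derivative and is constant,
or it has period `b`. In the periodic case, with `h w ≠ 0`, the function `h w • f - f w • h`
vanishes on `w + bℤ`. For `b < π / γ` this progression is denser than the Nyquist rate, so the
function is zero (`PW.eq_zero_of_progression`).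

The topological claims rest on compactness. If the moduli of the samples converge in `ℓ²`, a
subsequence of the samples converges pointwise, and convergence of the moduli excludes loss of mass,
so it converges in `ℓ²`. The lower sampling bound and completeness of `PW_γ` carry this back to
functions. Hence a sequence of classes whose images converge has a convergent subsequence. As the
maps are Lipschitz, their ranges are closed, and an inverse, where it exists, is continuous.
Closedness needs no injectivity, hence no bound on `b`. -/

noncomputable section

/-! ### Plancherel transform versus Fourier integrals -/

/-- Locally integrable functions with the same integrals against Schwartz functions agree almost
everywhere. -/
theorem ae_eq_of_integral_schwartz_mul_eq {u v : ℝ → ℂ} (hu : LocallyIntegrable u volume)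
    (hv : LocallyIntegrable v volume)
    (h : ∀ g : SchwartzMap ℝ ℂ, ∫ x, g x * u x = ∫ x, g x * v x) : u =ᵐ[volume] v := by
  refine ae_eq_of_integral_contDiff_smul_eq hu hv fun g hg hc => ?_
  have hs : HasCompactSupport (fun x => (g x : ℂ)) := hc.comp_left Complex.ofReal_zero
  have h1 := h (hs.toSchwartzMap (Complex.ofRealCLM.contDiff.comp hg))
  simp only [Complex.real_smul]
  exact h1

theorem Lp.locallyIntegrable_two (u : Lp ℂ 2 (volume : Measure ℝ)) :
    LocallyIntegrable u volume :=
  (Lp.memLp u).locallyIntegrable (by norm_num)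

/-- Fubini. It lets the Plancherel transform, known through its pairing with Schwartz functions, be
compared with a concrete integral. -/
theorem integral_schwartz_mul_fourierInv (g : SchwartzMap ℝ ℂ) {θ : ℝ → ℂ} (hθ : Integrable θ) :
    ∫ x, g x * 𝓕⁻ θ x = ∫ ξ, (𝓕⁻ g) ξ * θ ξ := by
  have h := VectorFourier.integral_fourierIntegral_smul_eq_flip (L := -innerₗ ℝ)
    (μ := (volume : Measure ℝ)) (ν := (volume : Measure ℝ)) (f := g) (g := θ)
    Real.continuous_fourierChar (continuous_inner (𝕜 := ℝ) (E := ℝ)).neg g.integrable hθ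
  rw [SchwartzMap.fourierInv_coe]
  have hflip : (-innerₗ ℝ : ℝ →ₗ[ℝ] ℝ →ₗ[ℝ] ℝ).flip = -innerₗ ℝ := by
    ext; simp
  rw [hflip] at h
  exact h.symm

/-- If the inverse Fourier integral of an integrable function is square integrable, then its
Plancherel transform is the given function. -/
theorem fourier_ae_eq_of_ae_eq_fourierInv {θ : ℝ → ℂ} (hθ : Integrable θ)
    {u : Lp ℂ 2 (volume : Measure ℝ)} (hu : u =ᵐ[volume] 𝓕⁻ θ) :
    (𝓕 u : Lp ℂ 2 (volume : Measure ℝ)) =ᵐ[volume] θ := by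
  refine ae_eq_of_integral_schwartz_mul_eq (Lp.locallyIntegrable_two _) hθ.locallyIntegrable
    fun g => ?_
  have h := congrArg (fun T => T g) (Lp.fourier_toTemperedDistribution_eq u)
  simp only [TemperedDistribution.fourier_apply, Lp.toTemperedDistribution_apply,
    smul_eq_mul] at h
  rw [← h]
  have h1 : ∫ x, (𝓕 g) x * u x = ∫ x, (𝓕 g) x * 𝓕⁻ θ x := by
    apply integral_congr_ae
    filter_upwards [hu] with x hx
    rw [hx]
  rw [h1, integral_schwartz_mul_fourierInv _ hθ, FourierTransform.fourierInv_fourier_eq]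

/-- On `L¹ ∩ L²` the inverse Plancherel transform is the inverse Fourier integral. -/
theorem fourierInv_toLp_ae_eq {θ : ℝ → ℂ} (hθ : Integrable θ) (h2 : MemLp θ 2 volume) :
    (𝓕⁻ h2.toLp : Lp ℂ 2 (volume : Measure ℝ)) =ᵐ[volume] 𝓕⁻ θ := by
  have hcont : Continuous (𝓕⁻ θ) :=
    VectorFourier.fourierIntegral_continuous Real.continuous_fourierChar
      (continuous_inner (𝕜 := ℝ) (E := ℝ)).neg hθ
  refine ae_eq_of_integral_schwartz_mul_eq (Lp.locallyIntegrable_two _) hcont.locallyIntegrable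
    fun g => ?_
  have h := congrArg (fun T => T g) (Lp.fourierInv_toTemperedDistribution_eq h2.toLp)
  simp only [TemperedDistribution.fourierInv_apply, Lp.toTemperedDistribution_apply,
    smul_eq_mul] at h
  rw [← h, integral_schwartz_mul_fourierInv _ hθ]
  apply integral_congr_ae
  filter_upwards [h2.coeFn_toLp] with x hx
  rw [hx]

/-- The Fourier-Laplace integral `∫ exp (2 π i z ξ) θ ξ dξ`. -/
def fourierLaplace (θ : ℝ → ℂ) (z : ℂ) : ℂ :=
  ∫ ξ : ℝ, Complex.exp (2 * Real.pi * Complex.I * z * ξ) * θ ξ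

theorem fourierLaplace_ofReal (θ : ℝ → ℂ) (x : ℝ) : fourierLaplace θ x = 𝓕⁻ θ x := by
  rw [Real.fourierInv_eq', fourierLaplace]
  congr 1
  ext ξ
  rw [smul_eq_mul]
  congr 2
  simp
  ring

theorem hasDerivAt_fourierLaplace {θ : ℝ → ℂ} {R : ℝ} (hθ : Integrable θ)
    (hR : ∀ ξ, R < |ξ| → θ ξ = 0) (z : ℂ) :
    HasDerivAt (fourierLaplace θ)
      (fourierLaplace (fun ξ => 2 * Real.pi * Complex.I * ξ * θ ξ) z) z := by
  -- Bounds the exponential for all `w` in the unit ball about `z` and all `|ξ| ≤ R`, which gives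
  -- the dominating function for differentiation under the integral.
  set C : ℝ := Real.exp (2 * Real.pi * (‖z‖ + 1) * R) with hC
  have hexp : ∀ w ∈ Metric.ball z 1, ∀ ξ : ℝ, |ξ| ≤ R →
      ‖Complex.exp (2 * Real.pi * Complex.I * w * ξ)‖ ≤ C := by
    intro w hw ξ hξ
    rw [Complex.norm_exp, hC]
    apply Real.exp_le_exp.2
    refine (Complex.re_le_norm _).trans ?_
    have h1 : ‖w‖ ≤ ‖z‖ + 1 := by
      have := norm_sub_norm_le w z
      have h2 : ‖w - z‖ < 1 := by simpa [dist_eq_norm] using hw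
      linarith
    simp only [norm_mul, Complex.norm_ofNat, Complex.norm_real, Complex.norm_I, mul_one,
      Real.norm_eq_abs, abs_of_pos Real.pi_pos]
    gcongr
  have hmeas : ∀ w : ℂ, AEStronglyMeasurable
      (fun ξ : ℝ => Complex.exp (2 * Real.pi * Complex.I * w * ξ) * θ ξ) volume := fun w =>
    (by fun_prop : Continuous fun ξ : ℝ =>
      Complex.exp (2 * Real.pi * Complex.I * w * ξ)).aestronglyMeasurable.mul hθ.1
  refine (hasDerivAt_integral_of_dominated_loc_of_deriv_le
    (F := fun w ξ => Complex.exp (2 * Real.pi * Complex.I * w * ξ) * θ ξ)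
    (F' := fun w ξ => Complex.exp (2 * Real.pi * Complex.I * w * ξ) *
      (2 * Real.pi * Complex.I * ξ * θ ξ))
    (bound := fun ξ => C * (2 * Real.pi * R) * ‖θ ξ‖)
    (Metric.ball_mem_nhds z one_pos) (Eventually.of_forall hmeas) ?_ ?_ ?_
    (hθ.norm.const_mul _) ?_).2
  · refine (hθ.norm.const_mul C).mono' (hmeas z) (ae_of_all _ fun ξ => ?_)
    by_cases h : |ξ| ≤ R
    · rw [norm_mul]
      gcongr
      exact hexp z (Metric.mem_ball_self one_pos) ξ h
    · simp [hR ξ (not_le.1 h)]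
  · exact (by fun_prop : Continuous fun ξ : ℝ =>
      Complex.exp (2 * Real.pi * Complex.I * z * ξ)).aestronglyMeasurable.mul
      ((by fun_prop : Continuous fun ξ : ℝ =>
        2 * Real.pi * Complex.I * (ξ : ℂ)).aestronglyMeasurable.mul hθ.1)
  · refine ae_of_all _ fun ξ w hw => ?_
    by_cases h : |ξ| ≤ R
    · simp only [norm_mul, Complex.norm_ofNat, Complex.norm_real, Complex.norm_I, mul_one,
        Real.norm_eq_abs, abs_of_pos Real.pi_pos]
      rw [mul_assoc C]
      gcongr
      exact hexp w hw ξ h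
    · simp [hR ξ (not_le.1 h)]
  · refine ae_of_all _ fun ξ w _ => ?_
    have h1 : HasDerivAt (fun w : ℂ => 2 * Real.pi * Complex.I * w * ξ)
        (2 * Real.pi * Complex.I * ξ) w := by
      simpa using ((hasDerivAt_id w).const_mul (2 * Real.pi * Complex.I)).mul_const (ξ : ℂ)
    exact (h1.cexp.mul_const (θ ξ)).congr_deriv (by ring)

/-- Entire functions that agree on the real line are equal. -/
theorem eq_of_differentiable_of_eq_ofReal {F G : ℂ → ℂ} (hF : Differentiable ℂ F)
    (hG : Differentiable ℂ G) (h : ∀ x : ℝ, F x = G x) : F = G := by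
  refine AnalyticOnNhd.eq_of_frequently_eq (z₀ := 0)
    (fun z _ => hF.analyticAt z) (fun z _ => hG.analyticAt z) ?_
  have h0 : Tendsto (fun x : ℝ => (x : ℂ)) (𝓝[≠] 0) (𝓝[≠] 0) := by
    refine tendsto_nhdsWithin_iff.2 ⟨?_, ?_⟩
    · exact (Complex.continuous_ofReal.tendsto' 0 0 (by simp)).mono_left nhdsWithin_le_nhds
    · filter_upwards [self_mem_nhdsWithin] with x hx
      simpa using hx
  exact h0.frequently (Eventually.of_forall h).frequently

/-! ### Structure of the Paley-Wiener spaces -/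

namespace PW

variable {γ : ℝ}

theorem toL2_ae_eq (f : PW γ) : f.toL2 =ᵐ[volume] fun x : ℝ => f x := f.memLp.coeFn_toLp

/-- A square integrable function supported in a bounded frequency band is integrable. -/
theorem integrable_of_memLp_of_band {θ : ℝ → ℂ} (h2 : MemLp θ 2 volume)
    (hs : ∀ ξ, γ < |2 * Real.pi * ξ| → θ ξ = 0) : Integrable θ := by
  -- The band has finite measure, so there `L²` is contained in `L¹`.
  have : IsFiniteMeasure
      ((volume : Measure ℝ).restrict (Metric.closedBall 0 (γ / (2 * Real.pi)))) :=
    ⟨by rw [Measure.restrict_apply_univ]; exact measure_closedBall_lt_top⟩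
  have h := ((h2.restrict (Metric.closedBall 0 (γ / (2 * Real.pi)))).integrable
    (by norm_num) : IntegrableOn θ (Metric.closedBall 0 (γ / (2 * Real.pi))) volume)
  refine (integrableOn_iff_integrable_of_support_subset fun ξ hξ => ?_).1 h
  by_contra hc
  refine hξ (hs ξ ?_)
  rw [mem_closedBall_zero_iff, not_le, Real.norm_eq_abs, div_lt_iff₀ Real.two_pi_pos] at hc
  rwa [abs_mul, abs_of_pos Real.two_pi_pos, mul_comm]

theorem hasDerivAt_fourierLaplace_of_band {θ : ℝ → ℂ} (hθ : Integrable θ)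
    (hs : ∀ ξ, γ < |2 * Real.pi * ξ| → θ ξ = 0) (z : ℂ) :
    HasDerivAt (fourierLaplace θ)
      (fourierLaplace (fun ξ => 2 * Real.pi * Complex.I * ξ * θ ξ) z) z := by
  refine hasDerivAt_fourierLaplace (R := γ / (2 * Real.pi)) hθ (fun ξ hξ => hs ξ ?_) z
  rw [div_lt_iff₀ Real.two_pi_pos] at hξ
  rwa [abs_mul, abs_of_pos Real.two_pi_pos, mul_comm]

/-- An entire function, square integrable on the real line, that is there the inverse Fourier
integral of an integrable function supported in the band. -/
def ofFourierInv (F : ℂ → ℂ) (hF : Differentiable ℂ F)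
    (h2 : MemLp (fun x : ℝ => F x) 2 (volume : Measure ℝ)) {θ : ℝ → ℂ} (hθ : Integrable θ)
    (hs : ∀ ξ, γ < |2 * Real.pi * ξ| → θ ξ = 0) (h : ∀ x : ℝ, F x = 𝓕⁻ θ x) : PW γ where
  toFun := F
  entire := hF
  memLp := h2
  bandlimited := by
    have h1 : (h2.toLp : Lp ℂ 2 (volume : Measure ℝ)) =ᵐ[volume] 𝓕⁻ θ :=
      h2.coeFn_toLp.trans (ae_of_all _ h)
    filter_upwards [fourier_ae_eq_of_ae_eq_fourierInv hθ h1] with ξ h3 h4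
    rw [h3, hs ξ h4]

/-- The element of `PW_γ` with a given square integrable Fourier transform. -/
def ofSpectrum (θ : ℝ → ℂ) (h2 : MemLp θ 2 volume)
    (hs : ∀ ξ, γ < |2 * Real.pi * ξ| → θ ξ = 0) : PW γ :=
  ofFourierInv (fourierLaplace θ)
    (fun z => (hasDerivAt_fourierLaplace_of_band
      (integrable_of_memLp_of_band h2 hs) hs z).differentiableAt)
    ((Lp.memLp (𝓕⁻ h2.toLp : Lp ℂ 2 (volume : Measure ℝ))).ae_eq
      ((fourierInv_toLp_ae_eq (integrable_of_memLp_of_band h2 hs) h2).trans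
        (ae_of_all _ fun x => (fourierLaplace_ofReal θ x).symm)))
    (integrable_of_memLp_of_band h2 hs) hs (fourierLaplace_ofReal θ)

theorem toL2_ofSpectrum {θ : ℝ → ℂ} (h2 : MemLp θ 2 volume)
    (hs : ∀ ξ, γ < |2 * Real.pi * ξ| → θ ξ = 0) :
    (ofSpectrum θ h2 hs).toL2 = 𝓕⁻ (h2.toLp : Lp ℂ 2 (volume : Measure ℝ)) := by
  apply Lp.ext
  refine (toL2_ae_eq _).trans (EventuallyEq.symm ?_)
  exact (fourierInv_toLp_ae_eq (integrable_of_memLp_of_band h2 hs) h2).trans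
    (ae_of_all _ fun x => (fourierLaplace_ofReal θ x).symm)

theorem norm_toL2_ofSpectrum {θ : ℝ → ℂ} (h2 : MemLp θ 2 volume)
    (hs : ∀ ξ, γ < |2 * Real.pi * ξ| → θ ξ = 0) :
    ‖(ofSpectrum θ h2 hs).toL2‖ = ‖(h2.toLp : Lp ℂ 2 (volume : Measure ℝ))‖ := by
  rw [toL2_ofSpectrum, ← Lp.norm_fourier_eq, FourierTransform.fourier_fourierInv_eq]

/-- The Fourier transform of `f`, made to vanish everywhere outside the band. -/
def spectrum (f : PW γ) : ℝ → ℂ :=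
  Set.indicator {ξ | |2 * Real.pi * ξ| ≤ γ} (𝓕 f.toL2 : Lp ℂ 2 (volume : Measure ℝ))

theorem spectrum_eq_zero (f : PW γ) (ξ : ℝ) (h : γ < |2 * Real.pi * ξ|) : f.spectrum ξ = 0 :=
  Set.indicator_of_notMem (s := {ξ : ℝ | |2 * Real.pi * ξ| ≤ γ}) (not_le.2 h) _

theorem spectrum_ae_eq (f : PW γ) :
    f.spectrum =ᵐ[volume] (𝓕 f.toL2 : Lp ℂ 2 (volume : Measure ℝ)) := by
  filter_upwards [f.bandlimited] with ξ h
  by_cases h1 : |2 * Real.pi * ξ| ≤ γ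
  · exact Set.indicator_of_mem (s := {ξ : ℝ | |2 * Real.pi * ξ| ≤ γ}) h1 _
  · rw [spectrum_eq_zero f ξ (not_le.1 h1)]
    exact (h (not_le.1 h1)).symm

theorem memLp_spectrum (f : PW γ) : MemLp f.spectrum 2 volume :=
  (Lp.memLp (𝓕 f.toL2 : Lp ℂ 2 (volume : Measure ℝ))).ae_eq f.spectrum_ae_eq.symm

theorem toLp_spectrum (f : PW γ) :
    f.memLp_spectrum.toLp = (𝓕 f.toL2 : Lp ℂ 2 (volume : Measure ℝ)) :=
  Lp.ext (f.memLp_spectrum.coeFn_toLp.trans f.spectrum_ae_eq)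

theorem integrable_spectrum (f : PW γ) : Integrable f.spectrum :=
  integrable_of_memLp_of_band f.memLp_spectrum f.spectrum_eq_zero

theorem ext_of_toL2_eq {f g : PW γ} (h : f.toL2 = g.toL2) : f = g := by
  have h1 : (fun x : ℝ => f x) =ᵐ[volume] fun x : ℝ => g x := by
    refine f.toL2_ae_eq.symm.trans ?_
    rw [h]
    exact g.toL2_ae_eq
  have h2 := (Continuous.ae_eq_iff_eq volume
    (f.entire.continuous.comp Complex.continuous_ofReal)
    (g.entire.continuous.comp Complex.continuous_ofReal)).1 h1
  exact PW.ext (eq_of_differentiable_of_eq_ofReal f.entire g.entire (congrFun h2))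

theorem ofSpectrum_spectrum (f : PW γ) :
    ofSpectrum f.spectrum f.memLp_spectrum f.spectrum_eq_zero = f := by
  apply ext_of_toL2_eq
  rw [toL2_ofSpectrum, toLp_spectrum, FourierTransform.fourierInv_fourier_eq]

/-- Both sides are entire and have the same `L²` class on the line, which determines an entire
function. All pointwise formulas below come from this one. -/
theorem apply_eq_fourierLaplace (f : PW γ) (z : ℂ) : f z = fourierLaplace f.spectrum z := by
  conv_lhs => rw [← f.ofSpectrum_spectrum]
  rfl

theorem apply_ofReal_eq (f : PW γ) (x : ℝ) : f x = 𝓕⁻ f.spectrum x := by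
  rw [apply_eq_fourierLaplace, fourierLaplace_ofReal]

theorem eq_zero_of_spectrum_ae_eq_zero {f : PW γ} (h : f.spectrum =ᵐ[volume] 0) (z : ℂ) :
    f z = 0 := by
  rw [apply_eq_fourierLaplace, fourierLaplace, integral_eq_zero_of_ae]
  filter_upwards [h] with ξ hξ
  simp [hξ]

theorem toL2_eq_zero {f : PW γ} (h : f.toL2 = 0) (z : ℂ) : f z = 0 := by
  have hF : (𝓕 f.toL2 : Lp ℂ 2 (volume : Measure ℝ)) = 0 := by
    rw [← norm_eq_zero, Lp.norm_fourier_eq, h, norm_zero]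
  refine eq_zero_of_spectrum_ae_eq_zero (f.spectrum_ae_eq.trans ?_) z
  rw [hF]
  exact Lp.coeFn_zero _ _ _

instance : Sub (PW γ) where
  sub f g :=
    { toFun := fun z => f z - g z
      entire := f.entire.sub g.entire
      memLp := f.memLp.sub g.memLp
      bandlimited := by
        have h : MemLp.toLp (fun x : ℝ => f x - g x) (f.memLp.sub g.memLp) = f.toL2 - g.toL2 :=
          MemLp.toLp_sub f.memLp g.memLp
        rw [h, show (𝓕 (f.toL2 - g.toL2) : Lp ℂ 2 (volume : Measure ℝ)) = 𝓕 f.toL2 - 𝓕 g.toL2 from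
          (Lp.fourierTransformₗᵢ ℝ ℂ).map_sub _ _]
        filter_upwards [f.bandlimited, g.bandlimited,
          Lp.coeFn_sub (𝓕 f.toL2 : Lp ℂ 2 (volume : Measure ℝ)) (𝓕 g.toL2)] with ξ h1 h2 h3 h4
        rw [h3, Pi.sub_apply]
        change (𝓕 f.memLp.toLp : Lp ℂ 2 (volume : Measure ℝ)) ξ -
          (𝓕 g.memLp.toLp : Lp ℂ 2 (volume : Measure ℝ)) ξ = 0
        rw [h1 h4, h2 h4, sub_zero] }

@[simp] theorem sub_apply (f g : PW γ) (z : ℂ) : (f - g) z = f z - g z := rfl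

theorem toL2_sub (f g : PW γ) : (f - g).toL2 = f.toL2 - g.toL2 :=
  MemLp.toLp_sub f.memLp g.memLp

/-- The inclusion of Paley-Wiener spaces. -/
def incl {δ : ℝ} (h : γ ≤ δ) (f : PW γ) : PW δ where
  toFun := f
  entire := f.entire
  memLp := f.memLp
  bandlimited := f.bandlimited.mono fun _ h1 h2 => h1 (h.trans_lt h2)

@[simp] theorem incl_apply {δ : ℝ} (h : γ ≤ δ) (f : PW γ) (z : ℂ) : f.incl h z = f z := rfl

theorem memLp_shift (f : PW γ) (b : ℝ) : MemLp (fun x : ℝ => f (x + b)) 2 volume := by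
  have h := f.memLp.comp_measurePreserving (measurePreserving_add_right volume b)
  simpa [Function.comp_def] using h

/-- Translation by a real number. -/
def shift (b : ℝ) (f : PW γ) : PW γ :=
  ofFourierInv (fun z => f (z + b)) (f.entire.comp (differentiable_id.add_const _))
    (f.memLp_shift b)
    (θ := fun ξ => Complex.exp (2 * Real.pi * Complex.I * b * ξ) * f.spectrum ξ)
    (by
      refine f.integrable_spectrum.norm.mono' ((by fun_prop : Continuous fun ξ : ℝ =>
        Complex.exp (2 * Real.pi * Complex.I * b * ξ)).aestronglyMeasurable.mul
        f.integrable_spectrum.1) (ae_of_all _ fun ξ => ?_)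
      rw [norm_mul, Complex.norm_exp]
      simp)
    (fun ξ h => by rw [f.spectrum_eq_zero ξ h, mul_zero])
    (fun x => by
      rw [← fourierLaplace_ofReal, apply_eq_fourierLaplace, fourierLaplace, fourierLaplace]
      congr 1
      ext ξ
      rw [← mul_assoc, ← Complex.exp_add]
      ring_nf)

@[simp] theorem shift_apply (b : ℝ) (f : PW γ) (z : ℂ) : f.shift b z = f (z + b) := rfl

theorem norm_toL2_shift (b : ℝ) (f : PW γ) : ‖(f.shift b).toL2‖ = ‖f.toL2‖ := by
  have h := eLpNorm_comp_measurePreserving (p := 2) f.memLp.1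
    (measurePreserving_add_right volume b)
  rw [toL2, toL2, Lp.norm_toLp, Lp.norm_toLp, ← h]
  congr 2
  ext x
  simp

theorem norm_two_pi_I_mul (ξ : ℝ) :
    ‖2 * Real.pi * Complex.I * (ξ : ℂ)‖ = |2 * Real.pi * ξ| := by
  simp [abs_mul]

theorem norm_two_pi_I_mul_spectrum_le (f : PW γ) (ξ : ℝ) :
    ‖2 * Real.pi * Complex.I * ξ * f.spectrum ξ‖ ≤ γ * ‖f.spectrum ξ‖ := by
  by_cases h : |2 * Real.pi * ξ| ≤ γ
  · rw [norm_mul, norm_two_pi_I_mul]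
    gcongr
  · simp [f.spectrum_eq_zero ξ (not_le.1 h)]

theorem memLp_deriv_spectrum (f : PW γ) :
    MemLp (fun ξ : ℝ => 2 * Real.pi * Complex.I * ξ * f.spectrum ξ) 2 volume :=
  f.memLp_spectrum.of_le_mul ((by fun_prop : Continuous fun ξ : ℝ =>
    2 * Real.pi * Complex.I * (ξ : ℂ)).aestronglyMeasurable.mul f.integrable_spectrum.1)
    (ae_of_all _ f.norm_two_pi_I_mul_spectrum_le)

/-- The derivative. -/
def derivative (f : PW γ) : PW γ :=
  ofSpectrum (fun ξ => 2 * Real.pi * Complex.I * ξ * f.spectrum ξ) f.memLp_deriv_spectrum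
    fun ξ h => by rw [f.spectrum_eq_zero ξ h, mul_zero]

@[simp] theorem derivative_apply (f : PW γ) (z : ℂ) : f.derivative z = deriv f z := by
  have h := hasDerivAt_fourierLaplace_of_band f.integrable_spectrum f.spectrum_eq_zero z
  rw [show fourierLaplace f.spectrum = f from funext fun z => (f.apply_eq_fourierLaplace z).symm]
    at h
  exact h.deriv.symm

/-- Bernstein's inequality in `L²`. -/
theorem norm_toL2_derivative_le (f : PW γ) : ‖f.derivative.toL2‖ ≤ γ * ‖f.toL2‖ := by
  rw [derivative, norm_toL2_ofSpectrum, ← Lp.norm_fourier_eq f.toL2, ← toLp_spectrum]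
  refine Lp.norm_le_mul_norm_of_ae_le_mul ?_
  filter_upwards [f.memLp_deriv_spectrum.coeFn_toLp, f.memLp_spectrum.coeFn_toLp] with ξ h1 h2
  rw [h1, h2]
  exact f.norm_two_pi_I_mul_spectrum_le ξ

theorem derivative_sub (f g : PW γ) : (f - g).derivative = f.derivative - g.derivative := by
  ext z
  rw [derivative_apply, sub_apply, derivative_apply, derivative_apply]
  exact deriv_fun_sub f.entire.differentiableAt g.entire.differentiableAt

theorem exists_bound (f : PW γ) : ∃ C, ∀ x : ℝ, ‖f x‖ ≤ C := by
  refine ⟨∫ ξ, ‖f.spectrum ξ‖, fun x => ?_⟩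
  rw [apply_ofReal_eq, Real.fourierInv_eq]
  refine (norm_integral_le_integral_norm _).trans (le_of_eq ?_)
  simp

/-- The product of two Paley-Wiener functions. -/
def mul {δ : ℝ} (f : PW γ) (g : PW δ) : PW (γ + δ) :=
  ofFourierInv (fun z => f z * g z) (f.entire.mul g.entire)
    (by
      obtain ⟨C, hC⟩ := f.exists_bound
      refine g.memLp.of_le_mul (c := C) (f.memLp.1.mul g.memLp.1) (ae_of_all _ fun x => ?_)
      rw [norm_mul]
      gcongr
      exact hC x)
    -- If `|2πξ| > γ + δ`, then for every `η` one of `η`, `ξ - η` lies outside its own band, so the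
    -- integrand of the convolution vanishes.
    (θ := convolution f.spectrum g.spectrum (ContinuousLinearMap.mul ℂ ℂ) volume)
    (f.integrable_spectrum.integrable_convolution _ g.integrable_spectrum)
    (fun ξ h => by
      refine integral_eq_zero_of_ae (ae_of_all _ fun η => ?_)
      by_cases h1 : γ < |2 * Real.pi * η|
      · simp [f.spectrum_eq_zero η h1]
      · have h2 : δ < |2 * Real.pi * (ξ - η)| := by
          have h3 := abs_add_le (2 * Real.pi * η) (2 * Real.pi * (ξ - η))
          rw [← mul_add, add_sub_cancel] at h3
          linarith
        simp [g.spectrum_eq_zero _ h2])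
    (fun x => by
      rw [apply_ofReal_eq, apply_ofReal_eq, Real.fourierInv_eq_fourier_neg,
        Real.fourierInv_eq_fourier_neg, Real.fourierInv_eq_fourier_neg,
        Real.fourier_mul_convolution_eq f.integrable_spectrum g.integrable_spectrum])

@[simp] theorem mul_apply {δ : ℝ} (f : PW γ) (g : PW δ) (z : ℂ) : f.mul g z = f z * g z := rfl

/-- `PW_γ` is complete. -/
theorem exists_tendsto_of_cauchySeq {f : ℕ → PW γ} (h : CauchySeq fun n => (f n).toL2) :
    ∃ g : PW γ, Tendsto (fun n => (f n).toL2) atTop (𝓝 g.toL2) := by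
  obtain ⟨u, hu⟩ := cauchySeq_tendsto_of_complete h
  have hF : Tendsto (fun n => (𝓕 (f n).toL2 : Lp ℂ 2 (volume : Measure ℝ))) atTop (𝓝 (𝓕 u)) :=
    ((FourierTransform.continuous_fourier (E := Lp ℂ 2 (volume : Measure ℝ))).tendsto u).comp hu
  -- Almost everywhere convergence along a subsequence of the transforms passes the band condition
  -- to the limit.
  obtain ⟨ns, -, hns⟩ := (tendstoInMeasure_of_tendsto_Lp hF).exists_seq_tendsto_ae
  have hband : ∀ᵐ ξ : ℝ, γ < |2 * Real.pi * ξ| →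
      (𝓕 u : Lp ℂ 2 (volume : Measure ℝ)) ξ = 0 := by
    filter_upwards [hns, ae_all_iff.2 fun n => (f n).bandlimited] with ξ h1 h2 h3
    refine tendsto_nhds_unique h1 ?_
    have h4 : ∀ n, (𝓕 (f n).toL2 : Lp ℂ 2 (volume : Measure ℝ)) ξ = 0 := fun n => h2 n h3
    simp [h4]
  set θ : ℝ → ℂ := Set.indicator {ξ | |2 * Real.pi * ξ| ≤ γ}
    (𝓕 u : Lp ℂ 2 (volume : Measure ℝ)) with hθ
  have hae : (𝓕 u : Lp ℂ 2 (volume : Measure ℝ)) =ᵐ[volume] θ := by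
    filter_upwards [hband] with ξ h1
    by_cases h2 : |2 * Real.pi * ξ| ≤ γ
    · exact (Set.indicator_of_mem (s := {ξ : ℝ | |2 * Real.pi * ξ| ≤ γ}) h2 _).symm
    · rw [h1 (not_le.1 h2)]
      exact (Set.indicator_of_notMem (s := {ξ : ℝ | |2 * Real.pi * ξ| ≤ γ}) h2 _).symm
  have hm : MemLp θ 2 volume := (Lp.memLp _).ae_eq hae
  refine ⟨ofSpectrum θ hm fun ξ hξ =>
    Set.indicator_of_notMem (s := {ξ : ℝ | |2 * Real.pi * ξ| ≤ γ}) (not_le.2 hξ) _, ?_⟩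
  have hLp : hm.toLp = (𝓕 u : Lp ℂ 2 (volume : Measure ℝ)) :=
    Lp.ext (hm.coeFn_toLp.trans hae.symm)
  rwa [toL2_ofSpectrum, hLp, FourierTransform.fourierInv_fourier_eq]

end PW

/-! ### Quotients of entire functions -/

theorem eq_zero_or_eq_zero_of_differentiable_mul {F G : ℂ → ℂ} (hF : Differentiable ℂ F)
    (hG : Differentiable ℂ G) (h : ∀ z, F z * G z = 0) : (∀ z, F z = 0) ∨ ∀ z, G z = 0 := by
  simpa using AnalyticOnNhd.eq_zero_or_eq_zero_of_mul_eq_zero (U := Set.univ)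
    (fun z _ => hF.analyticAt z) (fun z _ => hG.analyticAt z) (fun z _ => h z) isPreconnected_univ

/-- Entire functions with vanishing Wronskian are proportional. -/
theorem mul_eq_mul_of_wronskian_eq_zero {F G : ℂ → ℂ} (hF : Differentiable ℂ F)
    (hG : Differentiable ℂ G) (h : ∀ z, deriv F z * G z = F z * deriv G z) {w : ℂ}
    (hw : G w ≠ 0) (z : ℂ) : F z * G w = F w * G z := by
  obtain ⟨r, hr, hball⟩ := Metric.eventually_nhds_iff_ball.1
    (hG.continuous.continuousAt.eventually_ne hw)
  have hder : ∀ u ∈ Metric.ball w r, HasDerivAt (fun u => F u / G u) 0 u := fun u hu => by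
    refine ((hF u).hasDerivAt.div (hG u).hasDerivAt (hball u hu)).congr_deriv ?_
    rw [h u, sub_self, zero_div]
  have hconst : ∀ u ∈ Metric.ball w r, F u / G u = F w / G w := fun u hu =>
    Metric.isOpen_ball.is_const_of_deriv_eq_zero (convex_ball w r).isPreconnected
      (fun v hv => (hder v hv).differentiableAt.differentiableWithinAt)
      (fun v hv => (hder v hv).deriv) hu (Metric.mem_ball_self hr)
  have heq : (fun z => F z * G w) = fun z => F w * G z := by
    refine AnalyticOnNhd.eq_of_eventuallyEq (z₀ := w)
      (fun z _ => (hF.mul_const _).analyticAt z) (fun z _ => (hG.const_mul _).analyticAt z) ?_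
    filter_upwards [Metric.ball_mem_nhds w hr] with u hu
    have h1 := hconst u hu
    rwa [div_eq_div_iff (hball u hu) hw] at h1
  exact congrFun heq z

/-- Expand the product and replace `g G`, `g₁ G₁` and the mixed sum by their counterparts in `f`:
everything cancels. In the applications `F = f^♯` and `G = g^♯`. -/
theorem mul_sub_mul_eq_zero {f F g G f₁ F₁ g₁ G₁ : ℂ} (h₀ : f * F = g * G)
    (h₁ : f₁ * F₁ = g₁ * G₁) (h : f₁ * F + f * F₁ = g₁ * G + g * G₁) :
    (f₁ * g - f * g₁) * (f₁ * G - f * G₁) = 0 := by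
  linear_combination (-f₁ ^ 2) * h₀ - f ^ 2 * h₁ + f₁ * f * h

/-- If `F / G` has period `b`, it is constant on arithmetic progressions of step `b`. -/
theorem mul_shift_eq_mul_shift {F G : ℂ → ℂ} (hF : Differentiable ℂ F) (hG : Differentiable ℂ G)
    {w b : ℂ} (hw : G w ≠ 0) (h : ∀ z, F (z + b) * G z = F z * G (z + b)) (k : ℤ) (z : ℂ) :
    F (z + k * b) * G z = F z * G (z + k * b) := by
  have hnat : ∀ (k : ℕ) (z : ℂ), F (z + k * b) * G z = F z * G (z + k * b) := by
    intro k
    induction k with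
    | zero => simp
    | succ k ih =>
      have hshift : ∀ c : ℂ, Differentiable ℂ fun z : ℂ => z + c := fun c =>
        differentiable_id.add_const c
      -- Chaining the step-`b` relation with the induction hypothesis gives the claim times `G (z +
      -- k b)`. This factor is not identically zero, since at `w - k b` it equals `G w`.
      have h0 := eq_zero_or_eq_zero_of_differentiable_mul
        (F := fun z => F (z + (k * b + b)) * G z - F z * G (z + (k * b + b)))
        (G := fun z => G (z + k * b))
        (((hF.comp (hshift _)).mul hG).sub (hF.mul (hG.comp (hshift _))))
        (hG.comp (hshift _)) fun z => by
          have h1 := h (z + k * b)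
          rw [add_assoc] at h1
          linear_combination G z * h1 + G (z + (k * b + b)) * ih z
      rcases h0 with h0 | h0
      · intro z
        have h1 := sub_eq_zero.1 (h0 z)
        push_cast
        rwa [add_mul, one_mul]
      · exact absurd (by simpa using h0 (w - k * b)) hw
  obtain ⟨n, rfl | rfl⟩ := k.eq_nat_or_neg
  · simpa using hnat n z
  · have h1 := hnat n (z - n * b)
    rw [sub_add_cancel] at h1
    push_cast
    rw [neg_mul, ← sub_eq_add_neg]
    exact h1.symm

/-! ### Uniqueness up to equivalence -/

namespace PW

variable {γ : ℝ}

/-- A function in `PW_γ` that vanishes on an arithmetic progression of step less than `π / γ`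
is zero. -/
theorem eq_zero_of_progression (hγ : 0 < γ) (f : PW γ) {b w : ℝ} (hb : 0 < b)
    (hbγ : b < Real.pi / γ) (h : ∀ k : ℤ, f (w + k * b) = 0) (z : ℂ) : f z = 0 := by
  set g := f.shift w with hg
  set φ := g.spectrum with hφ
  -- Since `b < π / γ`, the band `|ξ| ≤ γ / (2π)` lies inside this interval of length `1 / b`. The
  -- Fourier coefficients of `φ` there are, up to a factor, the values `g (-n b)`, so Parseval
  -- forces `φ = 0`.
  have hab : -(1 / (2 * b)) < 1 / (2 * b) := neg_lt_self (by positivity)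
  have hsupp : ∀ ξ, ξ ∉ Set.Ioc (-(1 / (2 * b))) (1 / (2 * b)) → φ ξ = 0 := by
    intro ξ hξ
    apply g.spectrum_eq_zero
    by_contra hc
    apply hξ
    rw [not_lt] at hc
    have h1 : |ξ| < 1 / (2 * b) := by
      rw [lt_div_iff₀ hγ] at hbγ
      rw [abs_mul, abs_of_pos Real.two_pi_pos] at hc
      rw [lt_div_iff₀ (by positivity)]
      have h2 := mul_le_mul_of_nonneg_right hc hb.le
      nlinarith [Real.pi_pos]
    exact ⟨(abs_lt.1 h1).1, (abs_lt.1 h1).2.le⟩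
  have hcoef : ∀ n : ℤ, fourierCoeffOn hab φ n = 0 := by
    intro n
    have h1 : ∫ x in (-(1 / (2 * b)))..(1 / (2 * b)),
        fourier (-n) (x : AddCircle (1 / (2 * b) - -(1 / (2 * b)))) • φ x = 0 := by
      rw [intervalIntegral.integral_of_le hab.le,
        setIntegral_eq_integral_of_forall_compl_eq_zero fun ξ hξ => by rw [hsupp ξ hξ, smul_zero]]
      have h2 : g ((-n : ℤ) * b) = 0 := by
        rw [hg, shift_apply, add_comm]
        exact h (-n)
      rw [apply_eq_fourierLaplace, fourierLaplace] at h2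
      rw [← h2]
      congr 1
      ext ξ
      rw [fourier_coe_apply, smul_eq_mul]
      congr 2
      have hb' : (b : ℂ) ≠ 0 := by exact_mod_cast hb.ne'
      push_cast
      field_simp
      ring
    rw [fourierCoeffOn_eq_integral, h1, smul_zero]
  have hsum := hasSum_sq_fourierCoeffOn hab (g.memLp_spectrum.restrict _)
  simp only [← hφ, hcoef, norm_zero, ne_eq, OfNat.ofNat_ne_zero, not_false_eq_true, zero_pow] at hsum
  have h0 := hsum.unique hasSum_zero
  have hpos : (1 / (2 * b) - -(1 / (2 * b)))⁻¹ ≠ 0 := inv_ne_zero (sub_pos.2 hab).ne'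
  rw [smul_eq_zero, or_iff_right hpos, intervalIntegral.integral_of_le hab.le,
    setIntegral_eq_integral_of_forall_compl_eq_zero fun ξ hξ => by simp [hsupp ξ hξ],
    integral_eq_zero_iff_of_nonneg (fun ξ => by positivity)
      ((memLp_two_iff_integrable_sq_norm g.memLp_spectrum.1).1 g.memLp_spectrum)] at h0
  have hφ0 : g.spectrum =ᵐ[volume] 0 := by
    filter_upwards [h0] with ξ hξ
    simpa using hξ
  have h1 := eq_zero_of_spectrum_ae_eq_zero hφ0 (z - w)
  rwa [hg, shift_apply, sub_add_cancel] at h1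

theorem derivative_sharp (f : PW γ) : f.sharp.derivative = f.derivative.sharp := by
  ext z
  rw [derivative_apply, sharp_apply, derivative_apply]
  have h := (f.entire (conj z)).hasDerivAt.conj_conj
  rw [Complex.conj_conj] at h
  exact h.deriv

theorem mul_sharp_ofReal (f : PW γ) (x : ℝ) : f x * f.sharp x = ((‖f x‖ ^ 2 : ℝ) : ℂ) := by
  rw [sharp_apply, Complex.conj_ofReal, Complex.mul_conj, Complex.normSq_eq_norm_sq]

/-- Moduli on a set of sampling for `PW_{2γ}` determine `f f^♯`. -/
theorem mul_sharp_eq_of_norm_eq {t : ℤ → ℝ} (ht : IsSetOfSampling (2 * γ) t) {f g : PW γ}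
    (h : ∀ n, ‖f (t n)‖ = ‖g (t n)‖) (z : ℂ) : f z * f.sharp z = g z * g.sharp z := by
  obtain ⟨A, B, hA, -, hs⟩ := ht
  have hγ : γ + γ ≤ 2 * γ := (two_mul γ).ge
  -- The difference `f f^♯ - g g^♯` belongs to `PW_{2γ}` and vanishes at every sample, so the lower
  -- sampling bound kills its norm.
  have h1 := (hs ((f.mul f.sharp - g.mul g.sharp).incl hγ)).2.1
  have h2 : ∀ n, ((f.mul f.sharp - g.mul g.sharp).incl hγ) (t n) = 0 := fun n => by
    rw [incl_apply, sub_apply, mul_apply, mul_apply, mul_sharp_ofReal, mul_sharp_ofReal, h n,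
      sub_self]
  simp only [h2, norm_zero, ne_eq, OfNat.ofNat_ne_zero, not_false_eq_true, zero_pow,
    tsum_zero] at h1
  have h3 : ‖((f.mul f.sharp - g.mul g.sharp).incl hγ).toL2‖ ^ 2 ≤ 0 := by
    by_contra hc
    exact absurd h1 (not_le.2 (mul_pos hA (not_le.1 hc)))
  have h4 := toL2_eq_zero (norm_eq_zero.1 (pow_eq_zero_iff two_ne_zero |>.1
    (le_antisymm h3 (sq_nonneg _)))) z
  exact sub_eq_zero.1 h4

/-- The constant is `f w / g w`. It is unimodular because `w` is real, where `f f^♯ = g g^♯` reads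
`|f w| = |g w|`. -/
theorem exists_eq_smul_of_proportional {f g : PW γ}
    (h : ∀ z, f z * f.sharp z = g z * g.sharp z) {w : ℝ} (hw : g w ≠ 0)
    (hp : ∀ z, f z * g w = f w * g z) : ∃ c : ℂ, ‖c‖ = 1 ∧ f = c • g := by
  refine ⟨f w / g w, ?_, ?_⟩
  · have h1 := h w
    rw [mul_sharp_ofReal, mul_sharp_ofReal] at h1
    have h2 : ‖f w‖ = ‖g w‖ :=
      (sq_eq_sq₀ (norm_nonneg _) (norm_nonneg _)).1 (Complex.ofReal_injective h1)
    rw [norm_div, h2, div_self (norm_ne_zero_iff.2 hw)]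
  · ext z
    change f z = f w / g w * g z
    rw [div_mul_eq_mul_div, eq_div_iff hw, hp z]

/-- The second alternative reduces to the first with `g^♯` for `g`, as `g g^♯` is invariant under
`♯`. If `g` vanishes on the line, so does `f`. -/
theorem equivalent_of_proportional {f g : PW γ}
    (h : ∀ z, f z * f.sharp z = g z * g.sharp z)
    (hp : ∀ w : ℝ, g w ≠ 0 →
      (∀ z, f z * g w = f w * g z) ∨ ∀ z, f z * g.sharp w = f w * g.sharp z) :
    Equivalent f g := by
  by_cases hg : ∃ w : ℝ, g w ≠ 0
  · obtain ⟨w, hw⟩ := hg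
    rcases hp w hw with h1 | h1
    · obtain ⟨c, hc, h2⟩ := exists_eq_smul_of_proportional h hw h1
      exact ⟨c, hc, Or.inl h2⟩
    · have hw' : g.sharp w ≠ 0 := by
        rw [sharp_apply, Complex.conj_ofReal]
        exact (map_ne_zero _).2 hw
      obtain ⟨c, hc, h2⟩ := exists_eq_smul_of_proportional (g := g.sharp)
        (fun z => by rw [h z, sharp_sharp, mul_comm]) hw' h1
      exact ⟨c, hc, Or.inr h2⟩
  · push Not at hg
    have hf : ∀ x : ℝ, f x = g x := fun x => by
      have h1 := h x
      rw [mul_sharp_ofReal, hg x, zero_mul] at h1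
      rw [hg x]
      simpa using h1
    have h2 : f = g := PW.ext (eq_of_differentiable_of_eq_ofReal f.entire g.entire hf)
    rw [h2]
    exact Equivalent.refl g

theorem equivalent_of_derivative {f g : PW γ}
    (h₀ : ∀ z, f z * f.sharp z = g z * g.sharp z)
    (h₁ : ∀ z, f.derivative z * f.derivative.sharp z = g.derivative z * g.derivative.sharp z) :
    Equivalent f g := by
  have hder : ∀ u : PW γ, ∀ z, HasDerivAt u (u.derivative z) z := fun u z => by
    rw [derivative_apply]
    exact (u.entire z).hasDerivAt
  -- The mixed identity is the derivative of `h₀`.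
  have h : ∀ z, f.derivative z * f.sharp z + f z * f.derivative.sharp z =
      g.derivative z * g.sharp z + g z * g.derivative.sharp z := fun z => by
    rw [← derivative_sharp, ← derivative_sharp]
    refine ((hder f z).mul (hder f.sharp z)).unique ?_
    rw [show (f : ℂ → ℂ) * f.sharp = g * g.sharp from funext h₀]
    exact (hder g z).mul (hder g.sharp z)
  refine equivalent_of_proportional h₀ fun w hw => ?_
  have hw' : g.sharp w ≠ 0 := by
    rw [sharp_apply, Complex.conj_ofReal]
    exact (map_ne_zero _).2 hw
  rcases eq_zero_or_eq_zero_of_differentiable_mul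
      ((f.derivative.entire.mul g.entire).sub (f.entire.mul g.derivative.entire))
      ((f.derivative.entire.mul g.sharp.entire).sub (f.entire.mul g.derivative.sharp.entire))
      (fun z => mul_sub_mul_eq_zero (h₀ z) (h₁ z) (h z)) with h2 | h2
  · refine Or.inl (mul_eq_mul_of_wronskian_eq_zero f.entire g.entire (fun z => ?_) hw)
    rw [← derivative_apply, ← derivative_apply]
    exact sub_eq_zero.1 (h2 z)
  · refine Or.inr (mul_eq_mul_of_wronskian_eq_zero f.entire g.sharp.entire (fun z => ?_) hw')
    rw [← derivative_apply, ← derivative_apply, derivative_sharp]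
    exact sub_eq_zero.1 (h2 z)

/-- Functions in `PW_γ` whose quotient has a period less than `π / γ` are proportional. -/
theorem mul_eq_mul_of_shift (hγ : 0 < γ) {f g : PW γ} {b : ℝ} (hb : 0 < b)
    (hbγ : b < Real.pi / γ) (h : ∀ z, f (z + b) * g z = f z * g (z + b)) {w : ℝ}
    (hw : g w ≠ 0) (z : ℂ) : f z * g w = f w * g z := by
  have h1 := eq_zero_of_progression hγ (g w • f - f w • g) (w := w) hb hbγ (fun k => by
    have h2 := mul_shift_eq_mul_shift f.entire g.entire hw h k w
    rw [sub_apply, smul_apply, smul_apply]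
    linear_combination h2) z
  rw [sub_apply, smul_apply, smul_apply] at h1
  linear_combination h1

theorem equivalent_of_shift (hγ : 0 < γ) {f g : PW γ} {b : ℝ} (hb : 0 < b)
    (hbγ : b < Real.pi / γ) (h₀ : ∀ z, f z * f.sharp z = g z * g.sharp z)
    (h₁ : ∀ z, (f.shift b - f) z * (f.shift b - f).sharp z =
      (g.shift b - g) z * (g.shift b - g).sharp z) :
    Equivalent f g := by
  have hs : ∀ (u : PW γ) z, (u.shift b - u).sharp z = u.sharp (z + b) - u.sharp z := fun u z => by
    simp
  have hb₀ : ∀ z, f (z + b) * f.sharp (z + b) = g (z + b) * g.sharp (z + b) := fun z => h₀ _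
  -- The mixed identity is what remains of `h₁`, expanded, after removing `h₀` at `z` and at `z +
  -- b`.
  have h : ∀ z, f (z + b) * f.sharp z + f z * f.sharp (z + b) =
      g (z + b) * g.sharp z + g z * g.sharp (z + b) := fun z => by
    have h2 := h₁ z
    rw [hs, hs, sub_apply, sub_apply, shift_apply, shift_apply] at h2
    linear_combination h₀ z + hb₀ z - h2
  refine equivalent_of_proportional h₀ fun w hw => ?_
  have hw' : g.sharp w ≠ 0 := by
    rw [sharp_apply, Complex.conj_ofReal]
    exact (map_ne_zero _).2 hw
  rcases eq_zero_or_eq_zero_of_differentiable_mul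
      (((f.shift b).entire.mul g.entire).sub (f.entire.mul (g.shift b).entire))
      (((f.shift b).entire.mul g.sharp.entire).sub (f.entire.mul (g.sharp.shift b).entire))
      (fun z => mul_sub_mul_eq_zero (h₀ z) (hb₀ z) (h z)) with h2 | h2
  · exact Or.inl (mul_eq_mul_of_shift hγ hb hbγ (fun z => sub_eq_zero.1 (h2 z)) hw)
  · exact Or.inr (mul_eq_mul_of_shift hγ hb hbγ (fun z => sub_eq_zero.1 (h2 z)) hw')

end PW

/-! ### Compactness from moduli in `ℓ²` -/

theorem norm_toNorm_sub_toNorm_le (x y : lp (fun _ : ℤ => ℂ) 2) :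
    ‖lp.toNorm x - lp.toNorm y‖ ≤ ‖x - y‖ :=
  lp.norm_mono two_ne_zero fun n => by
    rw [lp.coeFn_sub, lp.coeFn_sub]
    exact abs_norm_sub_norm_le (x n) (y n)

theorem lp_two_norm_sq {E : Type*} [NormedAddCommGroup E] (x : lp (fun _ : ℤ => E) 2) :
    ‖x‖ ^ 2 = ∑' n, ‖x n‖ ^ 2 := by
  have h := lp.norm_rpow_eq_tsum (p := 2) (by norm_num) x
  simpa using h

/-- If the moduli converge in `ℓ²` and the values converge pointwise, the values converge
in `ℓ²`. -/
theorem tendsto_lp_of_tendsto_toNorm {x : ℕ → lp (fun _ : ℤ => ℂ) 2} {c : lp (fun _ : ℤ => ℂ) 2}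
    (hn : Tendsto (fun k => lp.toNorm (x k)) atTop (𝓝 (lp.toNorm c)))
    (hc : ∀ n, Tendsto (fun k => x k n) atTop (𝓝 (c n))) : Tendsto x atTop (𝓝 c) := by
  -- The truncated error is dominated by the square summable `2 ‖c n‖`, so dominated convergence
  -- applies to it. What truncation loses is controlled by the difference of the moduli.
  have hmem : ∀ k, Memℓp (fun n => min ‖x k n - c n‖ (2 * ‖c n‖)) 2 := fun k =>
    (lp.memℓp (x k - c)).mono' fun n => by
      rw [Real.norm_of_nonneg (by positivity)]
      exact min_le_left _ _
  let m : ℕ → lp (fun _ : ℤ => ℝ) 2 := fun k => ⟨_, hmem k⟩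
  have hm : ∀ k n, m k n = min ‖x k n - c n‖ (2 * ‖c n‖) := fun _ _ => rfl
  have hsq : Tendsto (fun k => ‖m k‖ ^ 2) atTop (𝓝 0) := by
    have hsum : Summable fun n => (2 * ‖c n‖) ^ 2 := by
      have h := ((lp.memℓp c).summable (by norm_num)).mul_left 4
      refine h.congr fun n => ?_
      simp only [ENNReal.toReal_ofNat, Real.rpow_ofNat]
      ring
    have h := tendsto_tsum_of_dominated_convergence
      (f := fun k n => ‖m k n‖ ^ 2) (g := fun _ => 0) hsum (fun n => ?_)
      (Eventually.of_forall (f := atTop) fun k n => ?_)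
    · simpa [lp_two_norm_sq] using h
    · have h1 : Tendsto (fun k => ‖x k n - c n‖) atTop (𝓝 0) :=
        tendsto_iff_norm_sub_tendsto_zero.1 (hc n)
      have h2 : Tendsto (fun k => ‖m k n‖) atTop (𝓝 0) := by
        refine squeeze_zero (fun _ => norm_nonneg _) (fun k => ?_) h1
        rw [hm, Real.norm_of_nonneg (by positivity)]
        exact min_le_left _ _
      simpa using h2.pow 2
    · rw [Real.norm_of_nonneg (by positivity), hm, Real.norm_of_nonneg (by positivity)]
      gcongr
      exact min_le_right _ _
  have hm0 : Tendsto (fun k => ‖m k‖) atTop (𝓝 0) := by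
    simpa using hsq.sqrt
  rw [tendsto_iff_norm_sub_tendsto_zero] at hn ⊢
  refine squeeze_zero (fun _ => norm_nonneg _) (fun k => ?_) (by simpa using hn.add hm0)
  have h1 : ‖x k - c‖ ≤ ‖lp.toNorm (lp.toNorm (x k) - lp.toNorm c) + m k‖ := by
    refine lp.norm_mono two_ne_zero fun n => ?_
    have h2 : (lp.toNorm (lp.toNorm (x k) - lp.toNorm c) + m k) n =
      |‖x k n‖ - ‖c n‖| + min ‖x k n - c n‖ (2 * ‖c n‖) := rfl
    rw [h2, Real.norm_of_nonneg (by positivity)]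
    change ‖x k n - c n‖ ≤ _
    rcases le_total ‖x k n - c n‖ (2 * ‖c n‖) with h | h
    · rw [min_eq_left h]
      linarith [abs_nonneg (‖x k n‖ - ‖c n‖)]
    · rw [min_eq_right h]
      -- Here `‖x - c‖ ≤ ‖x‖ + ‖c‖ = (‖x‖ - ‖c‖) + 2 ‖c‖`.
      linarith [norm_sub_le (x k n) (c n), le_abs_self (‖x k n‖ - ‖c n‖)]
  exact h1.trans ((norm_add_le _ _).trans (by rw [lp.norm_toNorm]))

/-- A sequence whose moduli converge in `ℓ²` has a convergent subsequence. -/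
theorem exists_subseq_tendsto_of_toNorm {x : ℕ → lp (fun _ : ℤ => ℂ) 2}
    {a : lp (fun _ : ℤ => ℝ) 2} (h : Tendsto (fun k => lp.toNorm (x k)) atTop (𝓝 a)) :
    ∃ (c : lp (fun _ : ℤ => ℂ) 2) (φ : ℕ → ℕ), StrictMono φ ∧
      Tendsto (x ∘ φ) atTop (𝓝 c) := by
  obtain ⟨M, hM⟩ := h.norm.bddAbove_range
  have hbound : ∀ k n, ‖x k n‖ ≤ M := fun k n =>
    (lp.norm_apply_le_norm two_ne_zero (x k) n).trans
      (lp.norm_toNorm.symm.le.trans (hM ⟨k, rfl⟩))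
  -- Tychonoff on a countable product of discs, which is metrizable, supplies a pointwise convergent
  -- subsequence.
  have hcpt : IsCompact (Set.univ.pi fun _ : ℤ => Metric.closedBall (0 : ℂ) M) :=
    isCompact_univ_pi fun _ => isCompact_closedBall _ _
  obtain ⟨c, -, φ, hφ, hc⟩ := hcpt.tendsto_subseq (x := fun k n => x k n) fun k n _ => by
    simpa using hbound k n
  have hcn : ∀ n, Tendsto (fun k => x (φ k) n) atTop (𝓝 (c n)) := fun n =>
    (tendsto_pi_nhds.1 hc) n
  have hsub := h.comp hφ.tendsto_atTop
  have hnorm : ∀ n, ‖c n‖ = a n := fun n => by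
    refine tendsto_nhds_unique (hcn n).norm ?_
    exact ((lp.lipschitzWith_one_eval 2 n).continuous.tendsto a).comp hsub
  have hmem : Memℓp c 2 := (lp.memℓp a).mono' fun n => by rw [← hnorm, norm_norm]
  refine ⟨⟨c, hmem⟩, φ, hφ, tendsto_lp_of_tendsto_toNorm ?_ hcn⟩
  have ha : lp.toNorm (⟨c, hmem⟩ : lp (fun _ : ℤ => ℂ) 2) = a := lp.ext (funext hnorm)
  rw [ha]
  exact hsub

namespace PW

variable {γ : ℝ}

/-- The sampling operator of a set of sampling. -/
theorem exists_samples (hγ : 0 < γ) {t : ℤ → ℝ} (ht : IsSetOfSampling (2 * γ) t) :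
    ∃ (S : PW γ → lp (fun _ : ℤ => ℂ) 2) (c C : ℝ), 0 < c ∧ 0 < C ∧
      (∀ f n, S f n = f (t n)) ∧ (∀ f, c * ‖f.toL2‖ ≤ ‖S f‖) ∧ ∀ f, ‖S f‖ ≤ C * ‖f.toL2‖ := by
  obtain ⟨A, B, hA, hB, hs⟩ := ht
  have hle : γ ≤ 2 * γ := by linarith
  have hmem : ∀ f : PW γ, Memℓp (fun n => f (t n)) 2 := fun f => by
    refine memℓp_gen ((hs (f.incl hle)).1.congr fun n => ?_)
    simp
  let S : PW γ → lp (fun _ : ℤ => ℂ) 2 := fun f => ⟨_, hmem f⟩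
  have hS : ∀ f, ‖S f‖ ^ 2 = ∑' n, ‖f (t n)‖ ^ 2 := fun f => lp_two_norm_sq (S f)
  refine ⟨S, √A, √B, Real.sqrt_pos.2 hA, Real.sqrt_pos.2 hB, fun _ _ => rfl,
    fun f => ?_, fun f => ?_⟩
  · refine (sq_le_sq₀ (by positivity) (norm_nonneg _)).1 ?_
    rw [mul_pow, Real.sq_sqrt hA.le, hS]
    exact (hs (f.incl hle)).2.1
  · refine (sq_le_sq₀ (norm_nonneg _) (by positivity)).1 ?_
    rw [mul_pow, Real.sq_sqrt hB.le, hS]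
    exact (hs (f.incl hle)).2.2

end PW

/-! ### The modulus map on the quotient -/

namespace PWQuotient

variable {γ : ℝ}

theorem dist_mk_le (f g : PW γ) : dist (mk f) (mk g) ≤ ‖f.toL2 - g.toL2‖ :=
  csInf_le (distSet_bddBelow _ _) ⟨f, g, rfl, rfl, rfl⟩

theorem le_dist {p q : PWQuotient γ} {r : ℝ}
    (h : ∀ f g, mk f = p → mk g = q → r ≤ ‖f.toL2 - g.toL2‖) : r ≤ dist p q :=
  le_csInf (distSet_nonempty _ _) (by rintro _ ⟨f, g, hf, hg, rfl⟩; exact h f g hf hg)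

end PWQuotient

open PWQuotient in
/-- The map recording the moduli of the samples of `f` and of `L f` on a set of sampling, for a
bounded operator `L` compatible with the equivalence relation. -/
theorem exists_modulus_map {γ : ℝ} (hγ : 0 < γ) {t : ℤ → ℝ} (ht : IsSetOfSampling (2 * γ) t)
    (L : PW γ → PW γ) (hsub : ∀ f g, L (f - g) = L f - L g)
    (hsmul : ∀ (c : ℂ) f, L (c • f) = c • L f) (hsharp : ∀ f, L f.sharp = (L f).sharp)
    {K : ℝ} (hK0 : 0 ≤ K) (hK : ∀ f, ‖(L f).toL2‖ ≤ K * ‖f.toL2‖) :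
    ∃ A : PWQuotient γ → PairSpace,
      (∀ (f : PW γ) (n : ℤ), (A (mk f)).fst n = ‖f (t n)‖ ∧ (A (mk f)).snd n = ‖L f (t n)‖) ∧
      IsClosed (Set.range A) ∧
      ((∀ f g : PW γ, (∀ z, f z * f.sharp z = g z * g.sharp z) →
          (∀ z, L f z * (L f).sharp z = L g z * (L g).sharp z) → PW.Equivalent f g) →
        ∃ hA : Function.Injective A, Continuous (Equiv.ofInjective A hA).symm) := by
  obtain ⟨S, c, C, hc, hC, hS, hlow, hup⟩ := PW.exists_samples hγ ht
  have hSsub : ∀ f g, S (f - g) = S f - S g := fun f g => lp.ext <| funext fun n => by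
    rw [lp.coeFn_sub, Pi.sub_apply, hS, hS, hS, PW.sub_apply]
  have hSnorm : ∀ f g : PW γ, PW.Equivalent f g → lp.toNorm (S f) = lp.toNorm (S g) := by
    rintro f g ⟨d, hd, rfl | rfl⟩ <;> refine lp.ext (funext fun n => ?_) <;>
      change ‖S _ n‖ = ‖S _ n‖ <;> simp [hS, hd]
  have hL : ∀ f g : PW γ, PW.Equivalent f g → PW.Equivalent (L f) (L g) := by
    rintro f g ⟨d, hd, rfl | rfl⟩
    · exact ⟨d, hd, Or.inl (hsmul _ _)⟩
    · exact ⟨d, hd, Or.inr (by rw [hsmul, hsharp])⟩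
  let A : PWQuotient γ → PairSpace := Quotient.lift
    (fun f => WithLp.toLp 2 (lp.toNorm (S f), lp.toNorm (S (L f)))) fun f g h => by
      rw [hSnorm f g h, hSnorm _ _ (hL f g h)]
  have hA : ∀ f, A (mk f) = WithLp.toLp 2 (lp.toNorm (S f), lp.toNorm (S (L f))) := fun _ => rfl
  have hval : ∀ (f : PW γ) (n : ℤ),
      (A (mk f)).fst n = ‖f (t n)‖ ∧ (A (mk f)).snd n = ‖L f (t n)‖ := fun f n =>
    ⟨congrArg norm (hS f n), congrArg norm (hS (L f) n)⟩
  have hdist : ∀ p q, dist (A p) (A q) ≤ (C + C * K) * dist p q := by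
    intro p q
    rw [← div_le_iff₀' (by positivity)]
    refine le_dist fun f g hf hg => ?_
    rw [div_le_iff₀' (by positivity), ← hf, ← hg, dist_eq_norm, hA, hA, ← WithLp.toLp_sub,
      Prod.mk_sub_mk]
    have h1 : ∀ u v : lp (fun _ : ℤ => ℝ) 2, ‖(WithLp.toLp 2 (u, v) : PairSpace)‖ ≤ ‖u‖ + ‖v‖ :=
      fun u v => by
        rw [WithLp.prod_norm_eq_of_L2]
        exact Real.sqrt_le_iff.2 ⟨by positivity, by
          change ‖u‖ ^ 2 + ‖v‖ ^ 2 ≤ _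
          nlinarith [norm_nonneg u, norm_nonneg v]⟩
    refine (h1 _ _).trans ?_
    have h2 := (norm_toNorm_sub_toNorm_le (S f) (S g)).trans ((hSsub f g ▸ hup (f - g)))
    have h3 := (norm_toNorm_sub_toNorm_le (S (L f)) (S (L g))).trans
      ((hSsub (L f) (L g) ▸ hup (L f - L g)))
    rw [← hsub] at h3
    have h4 := h3.trans (mul_le_mul_of_nonneg_left (hK (f - g)) hC.le)
    rw [PW.toL2_sub] at h2 h4
    linarith
  have hcont : Continuous A :=
    (LipschitzWith.of_dist_le' hdist).continuous
  -- Convergence of the first component, the moduli of `f` itself, is all that is used.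
  have hproper : ∀ (p : ℕ → PWQuotient γ) (y : PairSpace), Tendsto (A ∘ p) atTop (𝓝 y) →
      ∃ (q : PWQuotient γ) (φ : ℕ → ℕ), StrictMono φ ∧ Tendsto (p ∘ φ) atTop (𝓝 q) := by
    intro p y hy
    choose f hf using fun k => exists_rep (p k)
    have h1 : Tendsto (fun k => lp.toNorm (S (f k))) atTop (𝓝 y.fst) := by
      have h2 := ((WithLp.continuous_fst 2 _ _).tendsto y).comp hy
      refine h2.congr fun k => ?_
      simp only [Function.comp_apply]
      rw [← hf k, hA]
      rfl
    obtain ⟨d, φ, hφ, hd⟩ := exists_subseq_tendsto_of_toNorm h1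
    have hcauchy : CauchySeq fun k => (f (φ k)).toL2 := by
      rw [Metric.cauchySeq_iff]
      intro ε hε
      obtain ⟨N, hN⟩ := Metric.cauchySeq_iff.1 hd.cauchySeq (c * ε) (by positivity)
      refine ⟨N, fun m hm n hn => ?_⟩
      have h2 := hN m hm n hn
      rw [dist_eq_norm, Function.comp_apply, Function.comp_apply, ← hSsub] at h2
      have h3 := (hlow _).trans_lt h2
      rw [dist_eq_norm, ← PW.toL2_sub]
      exact lt_of_mul_lt_mul_left h3 hc.le
    obtain ⟨g, hg⟩ := PW.exists_tendsto_of_cauchySeq hcauchy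
    refine ⟨mk g, φ, hφ, tendsto_iff_dist_tendsto_zero.2 ?_⟩
    refine squeeze_zero (fun _ => dist_nonneg) (fun k => ?_)
      (tendsto_iff_norm_sub_tendsto_zero.1 hg)
    rw [Function.comp_apply, ← hf]
    exact dist_mk_le _ _
  refine ⟨A, hval, ?_, fun hinj => ?_⟩
  · refine isClosed_of_closure_subset fun y hy => ?_
    obtain ⟨u, hu, huy⟩ := mem_closure_iff_seq_limit.1 hy
    choose p hp using hu
    have hup : A ∘ p = u := funext hp
    obtain ⟨q, φ, hφ, hq⟩ := hproper p y (hup ▸ huy)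
    refine ⟨q, tendsto_nhds_unique ((hcont.tendsto q).comp hq) ?_⟩
    rw [← Function.comp_assoc, hup]
    exact huy.comp hφ.tendsto_atTop
  · have hA' : Function.Injective A := by
      intro p q h
      obtain ⟨f, rfl⟩ := exists_rep p
      obtain ⟨g, rfl⟩ := exists_rep q
      refine mk_eq_mk.2 (hinj f g (PW.mul_sharp_eq_of_norm_eq ht fun n => ?_)
        (PW.mul_sharp_eq_of_norm_eq ht fun n => ?_))
      · rw [← (hval f n).1, ← (hval g n).1, h]
      · rw [← (hval f n).2, ← (hval g n).2, h]
    refine ⟨hA', continuous_iff_seqContinuous.2 fun u y hu => ?_⟩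
    -- Every subsequence of preimages has a further convergent subsequence, and injectivity
    -- identifies its limit as the preimage of `y`.
    refine tendsto_of_subseq_tendsto fun ns hns => ?_
    have hAu : ∀ v : Set.range A, A ((Equiv.ofInjective A hA').symm v) = v := fun v =>
      congrArg Subtype.val ((Equiv.ofInjective A hA').apply_symm_apply v)
    have hlim : Tendsto (A ∘ fun k => (Equiv.ofInjective A hA').symm (u (ns k))) atTop
        (𝓝 (y : PairSpace)) := by
      have h1 := (continuous_subtype_val.tendsto y).comp (hu.comp hns)
      exact h1.congr fun k => (hAu _).symm
    obtain ⟨q, φ, hφ, hq⟩ := hproper _ _ hlim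
    have h2 : A q = y :=
      tendsto_nhds_unique ((hcont.tendsto q).comp hq) (hlim.comp hφ.tendsto_atTop)
    have h3 : q = (Equiv.ofInjective A hA').symm y := hA' (h2.trans (hAu y).symm)
    exact ⟨φ, h3 ▸ hq⟩

end

/-! ### The two sampling theorems -/

theorem mainTheorem4 (γ : ℝ) (hγ : 0 < γ) (t : ℤ → ℝ) (ht : IsSetOfSampling (2 * γ) t) :
    (∀ b : ℝ, 0 < b →
      ∃ A : PWQuotient γ → PairSpace,
        (∀ (f : PW γ) (n : ℤ),
          (A (PWQuotient.mk f)).fst n = ‖f (t n)‖ ∧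
          (A (PWQuotient.mk f)).snd n = ‖f (t n + b) - f (t n)‖) ∧
        IsClosed (Set.range A) ∧
        (b < Real.pi / γ →
          ∃ hA : Function.Injective A, Continuous (Equiv.ofInjective A hA).symm)) ∧
    (∃ D : PWQuotient γ → PairSpace,
      (∀ (f : PW γ) (n : ℤ),
        (D (PWQuotient.mk f)).fst n = ‖f (t n)‖ ∧
        (D (PWQuotient.mk f)).snd n = ‖deriv f (t n)‖) ∧
      IsClosed (Set.range D) ∧
      ∃ hD : Function.Injective D, Continuous (Equiv.ofInjective D hD).symm) := by
  constructor
  · intro b hb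
    obtain ⟨A, hval, hclosed, hinj⟩ := exists_modulus_map hγ ht (fun f => f.shift b - f)
      (fun f g => by
        ext z
        change f (z + b) - g (z + b) - (f z - g z) = f (z + b) - f z - (g (z + b) - g z)
        ring)
      (fun c f => by
        ext z
        change c * f (z + b) - c * f z = c * (f (z + b) - f z)
        ring)
      (fun f => by
        ext z
        change f.sharp (z + b) - f.sharp z = (f.shift b - f).sharp z
        simp)
      -- The bound is `K = 2` because translation is an isometry; for the derivative Bernstein's
      -- inequality gives `K = γ`.
      zero_le_two
      (fun f => by
        rw [PW.toL2_sub]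
        refine (norm_sub_le _ _).trans ?_
        rw [PW.norm_toL2_shift, two_mul])
    exact ⟨A, hval, hclosed, fun hbγ => hinj fun f g h₀ h₁ =>
      PW.equivalent_of_shift hγ hb hbγ h₀ h₁⟩
  · obtain ⟨D, hval, hclosed, hinj⟩ := exists_modulus_map hγ ht PW.derivative PW.derivative_sub
      (fun c f => by
        ext z
        change (c • f).derivative z = c * f.derivative z
        rw [PW.derivative_apply, PW.derivative_apply]
        exact deriv_const_mul _ f.entire.differentiableAt)
      PW.derivative_sharp hγ.le PW.norm_toL2_derivative_le
    refine ⟨D, fun f n => ?_, hclosed, hinj fun f g h₀ h₁ => PW.equivalent_of_derivative h₀ h₁⟩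
    rw [← PW.derivative_apply]
    exact hval f n
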